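/- Model. Let $B_n=\{0,1\}^n$, $|X|=\sum_i x_i$ and $a_X=|X|/n$ for $X=(x_1,\dots,x_n)\in B_n$. A quantum algorithm with $T$ queries prepares, on input $X$, the state $U_TQ_XU_{T-1}Q_X\cdots U_1Q_XU_0|\psi_0\rangle$ of some finite number of qubits, where the unit vector $|\psi_0\rangle$ and the unitaries $U_0,\dots,U_T$ do not depend on $X$ and the query is the unitary $Q_X|i,b,z\rangle=|i,b\oplus x_i,z\rangle$ (with an index register $i$ of $\lceil\log_2 n\rceil$ qubits, an answer qubit $b$, and a workspace $z$ of arbitrarily many qubits; the identity when $i$ is not a valid index). It then performs a projective measurement, independent of $X$, with outcomes $j\in\{0,\dots,M-1\}$, which occur with probabilities $p_X(j)$, and on outcome $j$ it returns a real number $\hat a(j)$ as approximation of $a_X$. For $\tfrac12<p\le 1$ its error on $X$ is $$e(X,T,p)=\inf\Big\{\gamma:\ \sum_{j:\,|a_X-\hat a(j)|\le\gamma}p_X(j)\ge p\Big\},$$ and its average probabilistic error for approximate counting, with respect to the uniform measure $\mu_1(X)=2^{-n}$ on $B_n$, is $$e_1^{\mathrm{avg}}(B_n,T,p)=n\sum_{X\in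 B_n}e(X,T,p)\,2^{-n}.$$ Corollary 3.2. There is an absolute constant $c>0$ such that the following two statements hold for every $p\in(\tfrac12,1]$. (1) Let $T=T(n)$ be a sequence of non-negative integers with $T(n)=o(n)$. Then for all sufficiently large $n$, every quantum algorithm with $T=T(n)$ queries satisfies $$e_1^{\mathrm{avg}}(B_n,T,p)\ \ge\ c\,\min\{n^{1/2},\,n/T\},$$ where $n/T$ is read as $+\infty$ if $T=0$. (2) Let $\Delta=\Delta(n)>0$ with $\Delta(n)=o(n^{1/2})$. Then for all sufficiently large $n$, every quantum algorithm, with any number $T$ of queries, for which $e_1^{\mathrm{avg}}(B_n,T,p)\le\Delta(n)$ satisfies $$T\ \ge\ c\,\min\{n/\Delta(n),\,n\}.$$ -/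

import Mathlib

open Filter Asymptotics

noncomputable section

namespace QuantumCounting

/-- The inputs: tuples of `n` Boolean variables. -/
abbrev Input (n : ℕ) : Type := Fin n → Bool

/-- The number of ones `|X|`. -/
def ones {n : ℕ} (X : Input n) : ℕ := (Finset.univ.filter fun i => X i = true).card

/-- The Boolean mean `a_X = |X| / n`. -/
def mean {n : ℕ} (X : Input n) : ℝ := (ones X : ℝ) / (n : ℝ)

/-- Labels `(i, b, z)` of the computational basis of `m = ⌈log₂ n⌉ + 1 + w` qubits: an index
register `i` of `⌈log₂ n⌉` qubits, one answer qubit `b`, and a workspace `z` of `w` qubits. -/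
abbrev Label (n w : ℕ) : Type := Fin (2 ^ Nat.clog 2 n) × Bool × Fin (2 ^ w)

/-- The Hilbert space of the `m` qubits. -/
abbrev QSpace (n w : ℕ) : Type := EuclideanSpace ℂ (Label n w)

/-- The bit of `X` at the address `i`; addresses beyond the input read `0`. -/
def bitAt {n k : ℕ} (X : Input n) (i : Fin k) : Bool :=
  if h : i.val < n then X ⟨i.val, h⟩ else false

/-- The permutation `(i, b, z) ↦ (i, b ⊕ x_i, z)` of the basis labels. -/
def queryPerm {n w : ℕ} (X : Input n) : Equiv.Perm (Label n w) :=
  Function.Involutive.toPerm (fun s => (s.1, xor s.2.1 (bitAt X s.1), s.2.2)) <| by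
    intro s
    simp

/-- The query `Q_X`: the unitary operator with `Q_X |i, b, z⟩ = |i, b ⊕ x_i, z⟩`. -/
def query {n w : ℕ} (X : Input n) : QSpace n w ≃ₗᵢ[ℂ] QSpace n w :=
  LinearIsometryEquiv.piLpCongrLeft 2 ℂ ℂ (queryPerm X)

/-- A quantum algorithm on `n` Boolean variables making `T` queries: it prepares
`U_T Q_X U_{T-1} Q_X ⋯ U_1 Q_X U_0 ψ₀`, performs a projective measurement with `M` outcomes, and on
outcome `j` outputs the number `estimate j` as approximation of the mean of the input. -/
structure QueryAlgorithm (n T : ℕ) where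
  /-- number of workspace qubits -/
  w : ℕ
  /-- initial state -/
  init : QSpace n w
  norm_init : ‖init‖ = 1
  /-- the unitaries `U_0, …, U_T`, which do not depend on the input -/
  U : Fin (T + 1) → (QSpace n w ≃ₗᵢ[ℂ] QSpace n w)
  /-- number of measurement outcomes -/
  M : ℕ
  /-- the measurement, a resolution of the identity by orthogonal projections -/
  proj : Fin M → (QSpace n w →L[ℂ] QSpace n w)
  isStarProjection_proj : ∀ j, IsStarProjection (proj j)
  sum_proj : ∑ j, proj j = 1
  /-- the value output on each outcome -/
  estimate : Fin M → ℝ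

namespace QueryAlgorithm

variable {n T : ℕ} (A : QueryAlgorithm n T)

/-- The state `U_t Q_X ⋯ U_1 Q_X U_0 ψ₀`, reached after `t` queries. -/
def state (X : Input n) (t : Fin (T + 1)) : QSpace n A.w :=
  Fin.induction (motive := fun _ => QSpace n A.w)
    (A.U 0 A.init) (fun s ψ => A.U s.succ (query X ψ)) t

/-- The state that is measured. -/
def finalState (X : Input n) : QSpace n A.w := A.state X (Fin.last T)

/-- The probability `p_X(j)` of the outcome `j` on input `X`. -/
def prob (X : Input n) (j : Fin A.M) : ℝ := ‖A.proj j (A.finalState X)‖ ^ 2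

open Classical in
/-- The error on input `X`: the infimum of the `γ` such that the output is within `γ` of the mean
of `X` with probability at least `p`. -/
def error (X : Input n) (p : ℝ) : ℝ :=
  sInf {γ : ℝ | p ≤ ∑ j ∈ Finset.univ.filter (fun j => |mean X - A.estimate j| ≤ γ), A.prob X j}

/-- The average probabilistic error for the mean, with respect to `μ`. -/
def avgError (μ : Input n → ℝ) (p : ℝ) : ℝ := ∑ X, A.error X p * μ X

/-- The average probabilistic error for approximate counting, with respect to `μ`. -/
def avgCountError (μ : Input n → ℝ) (p : ℝ) : ℝ := n * A.avgError μ p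

end QueryAlgorithm

/-- The uniform measure `μ₁(X) = 2^{-n}`. -/
def muOne (n : ℕ) : Input n → ℝ := fun _ => ((2 : ℝ) ^ n)⁻¹

end QuantumCounting

end

/-! ### Binomial coefficients near the middle -/

/-! The proof is an adversary argument near the middle of the cube. A single random permutation `σ`
yields coupled inputs with `k`, `k + d` and `k + 2d` ones, neighbours differing in at most `d`
positions. Given the lower input of a neighbouring pair, these positions are a random sample of its
zeros; given the upper one, of its ones. When both sets have at least `n / 4` elements, a query
places weight at most `4d / n` there on average, for either input, so the expected squared distance
of the two states grows by at most `16 d / n` per query (`sum_perm_norm_state_sub_sq_le`). If `T d`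
is at most a small multiple of `n`, the algorithm barely distinguishes the neighbouring inputs.

Three inputs are compared because `p` may be arbitrarily close to `1 / 2`. Accurate answers on all
three would give the middle state three disjoint events of probability nearly `p` each, of total
nearly `3p > 3/2`; two inputs would leave no margin uniform in `p`. Hence the mean errors on the
three levels add up to at least `d / 4` (`levelError_add_ge`).

About `√n` levels above `n / 2` have binomial mass of order `1 / √n` each, so for `d` up to a
multiple of `√n` the average error is at least a multiple of `d` (`avgCountError_ge_of_le_sqrt`).
Both statements follow by choosing `d`. -/

lemma sixteen_pow_le_centralBinom_sq {m : ℕ} (hm : 1 ≤ m) :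
    (16 : ℝ) ^ m ≤ 4 * m * (m.centralBinom : ℝ) ^ 2 := by
  induction m, hm using Nat.le_induction with
  | base => norm_num [Nat.centralBinom]
  | succ m hm ih =>
    have h : ((m : ℝ) + 1) * ((m + 1).centralBinom : ℝ) =
        2 * (2 * m + 1) * (m.centralBinom : ℝ) := by
      exact_mod_cast Nat.succ_mul_centralBinom_succ m
    have h0 : (0 : ℝ) < m + 1 := by positivity
    refine le_of_mul_le_mul_left ?_ h0
    calc ((m : ℝ) + 1) * 16 ^ (m + 1) = 16 * (m + 1) * 16 ^ m := by ring
      _ ≤ 16 * (m + 1) * (4 * m * (m.centralBinom : ℝ) ^ 2) := by gcongr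
      _ ≤ 4 * (2 * (2 * m + 1) * (m.centralBinom : ℝ)) ^ 2 := by
          nlinarith [sq_nonneg (m.centralBinom : ℝ)]
      _ = (m + 1) * (4 * ((m + 1 : ℕ) : ℝ) * ((m + 1).centralBinom : ℝ) ^ 2) := by
          rw [← h]
          push_cast
          ring

/-- A Bernoulli-type bound: moving `j` steps from the centre costs at most a factor `1 - j² / m`,
hence only a constant for `j` of order `√m`. -/
lemma centralBinom_mul_le_choose (m j : ℕ) :
    (m.centralBinom : ℝ) * (m - (j : ℝ) ^ 2) ≤ m * ((2 * m).choose (m + j) : ℝ) := by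
  induction j with
  | zero => simp [Nat.centralBinom, mul_comm]
  | succ j ih =>
    by_cases hj : m < (j + 1) ^ 2
    · have h1 : (m : ℝ) - ((j + 1 : ℕ) : ℝ) ^ 2 ≤ 0 := by
        rw [sub_nonpos]
        exact_mod_cast hj.le
      exact (mul_nonpos_of_nonneg_of_nonpos (by positivity) h1).trans (by positivity)
    · push Not at hj
      have hjm : j ≤ m := by nlinarith
      have hrec : ((2 * m).choose (m + (j + 1)) : ℝ) * (m + j + 1) =
          ((2 * m).choose (m + j) : ℝ) * (m - j) := by
        have := Nat.choose_succ_right_eq (2 * m) (m + j)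
        rw [show 2 * m - (m + j) = m - j by omega] at this
        have h2 : (((2 * m).choose (m + j + 1) * (m + j + 1) : ℕ) : ℝ) =
          (((2 * m).choose (m + j) * (m - j) : ℕ) : ℝ) := by rw [this]
        push_cast [Nat.cast_sub hjm] at h2
        exact h2
      have hpos : (0 : ℝ) < m + j + 1 := by positivity
      refine le_of_mul_le_mul_right ?_ hpos
      have hjm' : (j : ℝ) ≤ m := by exact_mod_cast hjm
      calc (m.centralBinom : ℝ) * (m - ((j + 1 : ℕ) : ℝ) ^ 2) * (m + j + 1)
          ≤ (m.centralBinom : ℝ) * (m - (j : ℝ) ^ 2) * (m - j) := by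
            push_cast
            rw [mul_assoc, mul_assoc]
            refine mul_le_mul_of_nonneg_left ?_ (by positivity)
            have hj0 : (0 : ℝ) ≤ j := by positivity
            -- The terms containing `m` cancel; the difference of the two sides is `j³ + (j + 1)³`.
            nlinarith [mul_nonneg hj0 hj0, mul_nonneg hj0 (mul_nonneg hj0 hj0)]
        _ ≤ m * ((2 * m).choose (m + j) : ℝ) * (m - j) :=
            mul_le_mul_of_nonneg_right ih (by linarith)
        _ = m * ((2 * m).choose (m + (j + 1)) : ℝ) * (m + j + 1) := by
            rw [mul_assoc, ← hrec, mul_assoc]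

lemma two_pow_le_choose_half_add {n j : ℕ} (hn : 2 ≤ n) (hj : 2 * j ^ 2 ≤ n / 2) :
    (2 : ℝ) ^ n ≤ 8 * Real.sqrt n * (n.choose (n / 2 + j) : ℝ) := by
  obtain ⟨m, hm⟩ : ∃ m, m = n / 2 := ⟨_, rfl⟩
  rw [← hm] at hj ⊢
  have hm1 : 1 ≤ m := by omega
  have hm0 : (0 : ℝ) < m := by exact_mod_cast hm1
  have h1 : (m.centralBinom : ℝ) ≤ 2 * ((2 * m).choose (m + j) : ℝ) := by
    have h := centralBinom_mul_le_choose m j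
    have hj' : 2 * (j : ℝ) ^ 2 ≤ m := by exact_mod_cast hj
    have h2 : (m.centralBinom : ℝ) * (m / 2) ≤ m.centralBinom * (m - (j : ℝ) ^ 2) :=
      mul_le_mul_of_nonneg_left (by linarith) (by positivity)
    refine le_of_mul_le_mul_left ?_ hm0
    linarith
  have h2 : (4 : ℝ) ^ m ≤ 2 * Real.sqrt m * m.centralBinom := by
    refine (sq_le_sq₀ (by positivity) (by positivity)).mp ?_
    have := sixteen_pow_le_centralBinom_sq hm1
    rw [mul_pow, mul_pow, Real.sq_sqrt hm0.le, ← pow_mul, mul_comm m 2, pow_mul]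
    norm_num
    exact this
  have h3 : (2 : ℝ) ^ n ≤ 2 * 4 ^ m := by
    calc (2 : ℝ) ^ n ≤ 2 ^ (2 * m + 1) := pow_le_pow_right₀ (by norm_num) (by omega)
      _ = 2 * 4 ^ m := by rw [pow_succ, pow_mul]; norm_num; ring
  have h4 : ((2 * m).choose (m + j) : ℝ) ≤ (n.choose (m + j) : ℝ) := by
    exact_mod_cast Nat.choose_le_choose (m + j) (show 2 * m ≤ n by omega)
  have h5 : Real.sqrt m ≤ Real.sqrt n := Real.sqrt_le_sqrt (by exact_mod_cast (by omega : m ≤ n))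
  calc (2 : ℝ) ^ n ≤ 2 * (2 * Real.sqrt m * m.centralBinom) := by linarith
    _ ≤ 2 * (2 * Real.sqrt n * (2 * (n.choose (m + j) : ℝ))) := by
        gcongr
        linarith
    _ = 8 * Real.sqrt n * (n.choose (m + j) : ℝ) := by ring

namespace QuantumCounting

/-! ### Queries and the distance between states -/

/-- The squared amplitude of `ψ` on the address `i`. -/
noncomputable def addressWeight {n w : ℕ} (ψ : QSpace n w) (i : Fin n) : ℝ :=
  ∑ s : Label n w, if s.1.val = i.val then ‖ψ s‖ ^ 2 else 0

lemma addressWeight_nonneg {n w : ℕ} (ψ : QSpace n w) (i : Fin n) : 0 ≤ addressWeight ψ i :=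
  Finset.sum_nonneg fun s _ => by split_ifs <;> positivity

lemma sum_addressWeight_le {n w : ℕ} (ψ : QSpace n w) : ∑ i, addressWeight ψ i ≤ ‖ψ‖ ^ 2 := by
  unfold addressWeight
  rw [Finset.sum_comm, EuclideanSpace.norm_sq_eq]
  refine Finset.sum_le_sum fun s _ => ?_
  by_cases h : s.1.val < n
  · rw [Finset.sum_eq_single (⟨s.1.val, h⟩ : Fin n)]
    · simp
    · intro i _ hi
      rw [if_neg]
      intro h'
      exact hi (Fin.ext h'.symm)
    · simp
  · rw [Finset.sum_eq_zero]
    · positivity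
    · intro i _
      rw [if_neg]
      have := i.2
      omega

lemma query_apply {n w : ℕ} (X : Input n) (u : QSpace n w) (s : Label n w) :
    query X u s = u (queryPerm X s) := rfl

lemma queryPerm_fst {n w : ℕ} (X : Input n) (s : Label n w) : (queryPerm X s).1 = s.1 := rfl

/-- On addresses where the bits agree, both queries permute the labels alike and preserve distances;
elsewhere `|a - b|² ≤ 2|a|² + 2|b|²`. Working with squares, and with the weights of both states,
makes the final bound linear in `T`; adding up norms by the triangle inequality would give `T²`. -/
lemma norm_query_sub_query_sq_le {n w : ℕ} (X Y : Input n) (u v : QSpace n w) :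
    ‖query X u - query Y v‖ ^ 2 ≤ ‖u - v‖ ^ 2 +
      2 * ∑ i ∈ Finset.univ.filter (fun i => X i ≠ Y i),
        (addressWeight u i + addressWeight v i) := by
  classical
  let d : Fin (2 ^ Nat.clog 2 n) → Prop := fun a => bitAt X a ≠ bitAt Y a
  have key : ∀ s : Label n w, ‖(query X u - query Y v) s‖ ^ 2 ≤ ‖(u - v) (queryPerm X s)‖ ^ 2 +
      2 * ((if d (queryPerm X s).1 then ‖u (queryPerm X s)‖ ^ 2 else 0) +
        (if d (queryPerm Y s).1 then ‖v (queryPerm Y s)‖ ^ 2 else 0)) := by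
    intro s
    rw [PiLp.sub_apply, PiLp.sub_apply, query_apply, query_apply, queryPerm_fst, queryPerm_fst]
    by_cases h : d s.1
    · rw [if_pos h, if_pos h]
      have h1 := norm_sub_le (u (queryPerm X s)) (v (queryPerm Y s))
      have h2 := norm_nonneg (u (queryPerm X s) - v (queryPerm Y s))
      nlinarith [sq_nonneg (‖u (queryPerm X s)‖ - ‖v (queryPerm Y s)‖),
        sq_nonneg ‖u (queryPerm X s) - v (queryPerm X s)‖]
    · rw [if_neg h, if_neg h]
      have : queryPerm X s = queryPerm Y s := by
        change (s.1, xor s.2.1 (bitAt X s.1), s.2.2) = (s.1, xor s.2.1 (bitAt Y s.1), s.2.2)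
        rw [not_not.mp h]
      rw [this]
      simp
  have hd : ∀ f : Label n w → ℝ, (∀ s, 0 ≤ f s) → (∑ s, if d s.1 then f s else 0) ≤
      ∑ i ∈ Finset.univ.filter (fun i => X i ≠ Y i),
        ∑ s : Label n w, if s.1.val = i.val then f s else 0 := by
    intro f hf
    rw [Finset.sum_comm]
    refine Finset.sum_le_sum fun s _ => ?_
    have h0 : ∀ i : Fin n, 0 ≤ if s.1.val = i.val then f s else 0 := fun i => by
      split_ifs
      exacts [hf s, le_rfl]
    split_ifs with h
    · have hs : s.1.val < n := by
        by_contra hs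
        exact h (by simp [bitAt, hs])
      refine le_trans ?_ (Finset.single_le_sum (fun i _ => h0 i)
        (a := (⟨s.1.val, hs⟩ : Fin n)) ?_)
      · simp
      · simpa [d, bitAt, hs] using h
    · exact Finset.sum_nonneg fun i _ => h0 i
  rw [EuclideanSpace.norm_sq_eq, EuclideanSpace.norm_sq_eq]
  refine (Finset.sum_le_sum fun s _ => key s).trans ?_
  rw [Finset.sum_add_distrib, ← Finset.mul_sum, Finset.sum_add_distrib,
    Equiv.sum_comp (queryPerm X) (fun s => ‖(u - v) s‖ ^ 2),
    Equiv.sum_comp (queryPerm X) (fun s => if d s.1 then ‖u s‖ ^ 2 else 0),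
    Equiv.sum_comp (queryPerm Y) (fun s => if d s.1 then ‖v s‖ ^ 2 else 0),
    Finset.sum_add_distrib]
  have h1 := hd (fun s => ‖u s‖ ^ 2) (fun s => by positivity)
  have h2 := hd (fun s => ‖v s‖ ^ 2) (fun s => by positivity)
  unfold addressWeight
  linarith

/-! ### Averages over permutations -/

/-- The input whose ones are the `k` positions that `σ` sends below `k`. -/
def thresholdInput {n : ℕ} (k : ℕ) (σ : Equiv.Perm (Fin n)) : Input n :=
  fun i => decide ((σ i).val < k)

lemma ones_thresholdInput {n k : ℕ} (hk : k ≤ n) (σ : Equiv.Perm (Fin n)) :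
    ones (thresholdInput k σ) = k := by
  unfold ones thresholdInput
  have : (Finset.univ.filter fun i : Fin n => decide ((σ i).val < k) = true)
      = (Finset.univ.filter fun i : Fin n => i.val < k).map σ.symm.toEmbedding := by
    ext i
    simp
  rw [this, Finset.card_map, Fin.card_filter_val_lt, min_eq_right hk]

/-- `hS` puts `S` on one side of the threshold `k`, so composing `σ` with a transposition inside `S`
leaves the input unchanged. The sums for all elements of `S` are therefore equal, and together they
are at most `∑ σ, 1`. -/
lemma card_mul_sum_perm_le {n k : ℕ} (g : Input n → Fin n → ℝ)
    (hg : ∀ X i, 0 ≤ g X i) (hg1 : ∀ X, ∑ i, g X i ≤ 1) (S : Finset (Fin n))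
    (hS : ∀ a ∈ S, ∀ b ∈ S, a.val < k → b.val < k) {j : Fin n} (hj : j ∈ S) :
    (S.card : ℝ) * ∑ σ : Equiv.Perm (Fin n), g (thresholdInput k σ) (σ.symm j) ≤
      (n.factorial : ℝ) := by
  have hsymm : ∀ a ∈ S, ∑ σ : Equiv.Perm (Fin n), g (thresholdInput k σ) (σ.symm a) =
      ∑ σ : Equiv.Perm (Fin n), g (thresholdInput k σ) (σ.symm j) := by
    intro a ha
    rw [← Equiv.sum_comp (Equiv.mulLeft (Equiv.swap a j))
      (fun σ : Equiv.Perm (Fin n) => g (thresholdInput k σ) (σ.symm a))]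
    refine Finset.sum_congr rfl fun σ _ => ?_
    have h1 : thresholdInput k (Equiv.swap a j * σ) = thresholdInput k σ := by
      funext i
      simp only [thresholdInput, Equiv.Perm.mul_apply]
      congr 1
      rcases eq_or_ne (σ i) a with h | h
      · rw [h, Equiv.swap_apply_left]
        exact propext ⟨hS j hj a ha, hS a ha j hj⟩
      · rcases eq_or_ne (σ i) j with h' | h'
        · rw [h', Equiv.swap_apply_right]
          exact propext ⟨hS a ha j hj, hS j hj a ha⟩
        · rw [Equiv.swap_apply_of_ne_of_ne h h']
    have h2 : (Equiv.swap a j * σ).symm a = σ.symm j := by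
      rw [Equiv.symm_apply_eq]
      simp
    simp only [Equiv.coe_mulLeft, h1, h2]
  calc (S.card : ℝ) * ∑ σ : Equiv.Perm (Fin n), g (thresholdInput k σ) (σ.symm j)
      = ∑ a ∈ S, ∑ σ : Equiv.Perm (Fin n), g (thresholdInput k σ) (σ.symm a) := by
        rw [Finset.sum_congr rfl hsymm, Finset.sum_const, nsmul_eq_mul]
    _ = ∑ σ : Equiv.Perm (Fin n), ∑ a ∈ S, g (thresholdInput k σ) (σ.symm a) :=
        Finset.sum_comm
    _ ≤ ∑ _σ : Equiv.Perm (Fin n), (1 : ℝ) := by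
        refine Finset.sum_le_sum fun σ _ => ?_
        refine le_trans ?_ (hg1 (thresholdInput k σ))
        rw [← Equiv.sum_comp σ.symm]
        exact Finset.sum_le_sum_of_subset_of_nonneg (Finset.subset_univ _)
          fun i _ _ => hg _ _
    _ = (n.factorial : ℝ) := by
        rw [Finset.sum_const, Finset.card_univ, Fintype.card_perm, Fintype.card_fin]
        simp

lemma sum_filter_thresholdInput_ne {n : ℕ} (k d : ℕ) (σ : Equiv.Perm (Fin n))
    (f : Fin n → ℝ) :
    ∑ i ∈ Finset.univ.filter (fun i => thresholdInput k σ i ≠ thresholdInput (k + d) σ i), f i =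
      ∑ j ∈ Finset.univ.filter (fun j : Fin n => k ≤ j.val ∧ j.val < k + d), f (σ.symm j) := by
  rw [Finset.sum_filter, Finset.sum_filter,
    ← Equiv.sum_comp σ (fun j : Fin n => if k ≤ j.val ∧ j.val < k + d then f (σ.symm j) else 0)]
  refine Finset.sum_congr rfl fun i _ => ?_
  rw [Equiv.symm_apply_apply]
  congr 1
  simp only [thresholdInput, ne_eq, decide_eq_decide, eq_iff_iff]
  omega

lemma card_filter_between_le {n : ℕ} (k d : ℕ) :
    (Finset.univ.filter (fun j : Fin n => k ≤ j.val ∧ j.val < k + d)).card ≤ d := by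
  rw [← Finset.card_map Fin.valEmbedding]
  refine (Finset.card_le_card (t := Finset.Ico k (k + d)) ?_).trans (by simp)
  intro x hx
  simp only [Finset.mem_map, Finset.mem_filter, Finset.mem_univ, true_and] at hx
  obtain ⟨j, hj, rfl⟩ := hx
  simpa using hj

/-- Averaged over `σ`, little weight lies on the addresses at which two neighbouring threshold
inputs differ. -/
lemma sum_perm_weight_le {n k d : ℕ} (l : ℕ) (N : ℝ) (hN : 0 < N)
    (g : Input n → Fin n → ℝ) (hg : ∀ X i, 0 ≤ g X i) (hg1 : ∀ X, ∑ i, g X i ≤ 1)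
    (S : Finset (Fin n)) (hS : ∀ a ∈ S, ∀ b ∈ S, a.val < l → b.val < l) (hSN : N ≤ S.card)
    (hd : ∀ j : Fin n, k ≤ j.val → j.val < k + d → j ∈ S) :
    ∑ σ : Equiv.Perm (Fin n),
      ∑ i ∈ Finset.univ.filter (fun i => thresholdInput k σ i ≠ thresholdInput (k + d) σ i),
        g (thresholdInput l σ) i ≤ d * (n.factorial : ℝ) / N := by
  simp only [sum_filter_thresholdInput_ne]
  rw [Finset.sum_comm]
  have h : ∀ j ∈ Finset.univ.filter (fun j : Fin n => k ≤ j.val ∧ j.val < k + d),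
      ∑ σ : Equiv.Perm (Fin n), g (thresholdInput l σ) (σ.symm j) ≤ (n.factorial : ℝ) / N := by
    intro j hj
    simp only [Finset.mem_filter, Finset.mem_univ, true_and] at hj
    have h1 := card_mul_sum_perm_le g hg hg1 S hS (hd j hj.1 hj.2)
    have h2 : 0 ≤ ∑ σ : Equiv.Perm (Fin n), g (thresholdInput l σ) (σ.symm j) :=
      Finset.sum_nonneg fun σ _ => hg _ _
    rw [le_div_iff₀ hN]
    nlinarith
  refine (Finset.sum_le_card_nsmul _ _ _ h).trans ?_
  rw [nsmul_eq_mul, mul_div_assoc]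
  exact mul_le_mul_of_nonneg_right (by exact_mod_cast card_filter_between_le k d) (by positivity)

end QuantumCounting

namespace QuantumCounting

namespace QueryAlgorithm

/-! ### States of an algorithm on neighbouring inputs -/

variable {n T : ℕ} (A : QueryAlgorithm n T)

lemma state_zero (X : Input n) : A.state X 0 = A.U 0 A.init := rfl

lemma state_succ (X : Input n) (s : Fin T) :
    A.state X s.succ = A.U s.succ (query X (A.state X s.castSucc)) := by
  simp [state, Fin.induction_succ]

lemma norm_state (X : Input n) (t : Fin (T + 1)) : ‖A.state X t‖ = 1 := by
  induction t using Fin.induction with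
  | zero => rw [state_zero, LinearIsometryEquiv.norm_map, A.norm_init]
  | succ s ih => rw [state_succ, LinearIsometryEquiv.norm_map, LinearIsometryEquiv.norm_map, ih]

lemma norm_state_succ_sub_sq_le (X Y : Input n) (s : Fin T) :
    ‖A.state X s.succ - A.state Y s.succ‖ ^ 2 ≤
      ‖A.state X s.castSucc - A.state Y s.castSucc‖ ^ 2 +
      2 * ∑ i ∈ Finset.univ.filter (fun i => X i ≠ Y i),
        (addressWeight (A.state X s.castSucc) i + addressWeight (A.state Y s.castSucc) i) := by
  rw [state_succ, state_succ, ← map_sub, LinearIsometryEquiv.norm_map]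
  exact norm_query_sub_query_sq_le X Y _ _

lemma sum_addressWeight_state_le (X : Input n) (t : Fin (T + 1)) :
    ∑ i, addressWeight (A.state X t) i ≤ 1 := by
  simpa [A.norm_state X t] using sum_addressWeight_le (A.state X t)

/-- Here `S` corresponds to the zeros of the lower input; for the upper input the ones play this
role. -/
lemma sum_perm_weight_lower_le {k d : ℕ} (hk : 4 * k ≤ 3 * n) (hn : 0 < n)
    (t : Fin (T + 1)) :
    ∑ σ : Equiv.Perm (Fin n),
      ∑ i ∈ Finset.univ.filter (fun i => thresholdInput k σ i ≠ thresholdInput (k + d) σ i),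
        addressWeight (A.state (thresholdInput k σ) t) i ≤ d * (n.factorial : ℝ) / (n / 4) := by
  refine sum_perm_weight_le k (n / 4) (by positivity) (fun X i => addressWeight (A.state X t) i)
    (fun X i => addressWeight_nonneg _ _) (fun X => A.sum_addressWeight_state_le X t)
    (Finset.univ.filter fun j : Fin n => ¬ j.val < k) ?_ ?_ ?_
  · intro a ha
    simp only [Finset.mem_filter] at ha
    exact fun _ _ h => absurd h ha.2
  · have h := Finset.card_filter_add_card_filter_not (s := (Finset.univ : Finset (Fin n)))
      (fun j : Fin n => j.val < k)
    rw [Fin.card_filter_val_lt, Finset.card_univ, Fintype.card_fin] at h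
    have h' : n ≤ 4 * (Finset.univ.filter fun j : Fin n => ¬ j.val < k).card := by omega
    have h'' : (n : ℝ) ≤ 4 * ((Finset.univ.filter fun j : Fin n => ¬ j.val < k).card : ℝ) := by
      exact_mod_cast h'
    linarith
  · intro j hj _
    simpa using hj

lemma sum_perm_weight_upper_le {k d : ℕ} (hk : n ≤ 4 * (k + d)) (hn : 0 < n)
    (t : Fin (T + 1)) :
    ∑ σ : Equiv.Perm (Fin n),
      ∑ i ∈ Finset.univ.filter (fun i => thresholdInput k σ i ≠ thresholdInput (k + d) σ i),
        addressWeight (A.state (thresholdInput (k + d) σ) t) i ≤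
      d * (n.factorial : ℝ) / (n / 4) := by
  refine sum_perm_weight_le (k + d) (n / 4) (by positivity)
    (fun X i => addressWeight (A.state X t) i)
    (fun X i => addressWeight_nonneg _ _) (fun X => A.sum_addressWeight_state_le X t)
    (Finset.univ.filter fun j : Fin n => j.val < k + d) ?_ ?_ ?_
  · intro a _ b hb _
    simp only [Finset.mem_filter] at hb
    exact hb.2
  · rw [Fin.card_filter_val_lt]
    have h' : n ≤ 4 * min n (k + d) := by omega
    have h'' : (n : ℝ) ≤ 4 * ((min n (k + d) : ℕ) : ℝ) := by exact_mod_cast h'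
    linarith
  · intro j _ hj
    simpa using hj

/-- On average over `σ`, each query increases the squared distance of the states reached from two
neighbouring threshold inputs by at most `16 d / n`. -/
lemma sum_perm_norm_state_sub_sq_le {k d : ℕ} (hk : 4 * k ≤ 3 * n) (hk' : n ≤ 4 * (k + d))
    (hn : 0 < n) (t : Fin (T + 1)) :
    ∑ σ : Equiv.Perm (Fin n),
      ‖A.state (thresholdInput k σ) t - A.state (thresholdInput (k + d) σ) t‖ ^ 2 ≤
      t.val * (16 * d / n) * (n.factorial : ℝ) := by
  induction t using Fin.induction with
  | zero => simp [state_zero]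
  | succ s ih =>
    refine (Finset.sum_le_sum fun σ _ => A.norm_state_succ_sub_sq_le _ _ s).trans ?_
    simp only [Finset.sum_add_distrib, ← Finset.mul_sum]
    have h1 := A.sum_perm_weight_lower_le (d := d) hk hn s.castSucc
    have h2 := A.sum_perm_weight_upper_le hk' hn s.castSucc
    have h3 : (d * (n.factorial : ℝ) / (n / 4)) = 4 * d / n * (n.factorial : ℝ) := by
      field_simp
    rw [h3] at h1 h2
    rw [Fin.val_castSucc] at ih
    rw [Fin.val_succ]
    push_cast
    have h4 : ((s.val : ℝ) + 1) * (16 * d / n) * (n.factorial : ℝ) =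
        s.val * (16 * d / n) * (n.factorial : ℝ) + 4 * (4 * d / n * (n.factorial : ℝ)) := by ring
    rw [h4]
    linarith

/-! ### Outcome probabilities and errors -/

lemma sum_norm_proj_sq (ψ : QSpace n A.w) : ∑ j, ‖A.proj j ψ‖ ^ 2 = ‖ψ‖ ^ 2 := by
  have h : ∀ j, ‖A.proj j ψ‖ ^ 2 = RCLike.re (inner ℂ ψ (A.proj j ψ)) := by
    intro j
    have hp := A.isStarProjection_proj j
    have h1 : inner ℂ (A.proj j ψ) (A.proj j ψ) = inner ℂ ψ (A.proj j (A.proj j ψ)) := by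
      conv_lhs => rw [← ContinuousLinearMap.adjoint_inner_right]
      rw [← ContinuousLinearMap.star_eq_adjoint, hp.isSelfAdjoint.star_eq]
    have h2 : A.proj j (A.proj j ψ) = A.proj j ψ := by
      conv_rhs => rw [← hp.isIdempotentElem.eq]
      rfl
    rw [← inner_self_eq_norm_sq (𝕜 := ℂ), h1, h2]
  simp only [h]
  rw [← map_sum, ← inner_sum, ← sum_apply, A.sum_proj,
    one_apply_eq_self, inner_self_eq_norm_sq]

lemma norm_finalState (X : Input n) : ‖A.finalState X‖ = 1 := A.norm_state X _

lemma prob_nonneg (X : Input n) (j : Fin A.M) : 0 ≤ A.prob X j := by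
  unfold prob
  positivity

lemma sum_prob (X : Input n) : ∑ j, A.prob X j = 1 := by
  simp only [prob, sum_norm_proj_sq, norm_finalState, one_pow]

/-- From `(a + b)² ≤ 9/8 a² + 9 b²`. A factor below `2` on the first term is essential for a margin
that survives as `p` tends to `1 / 2`. -/
lemma sum_prob_le (X Y : Input n) (I : Finset (Fin A.M)) :
    ∑ j ∈ I, A.prob X j ≤
      9 / 8 * ∑ j ∈ I, A.prob Y j + 9 * ‖A.finalState X - A.finalState Y‖ ^ 2 := by
  rw [← A.sum_norm_proj_sq (A.finalState X - A.finalState Y)]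
  have h : ∑ j ∈ I, ‖A.proj j (A.finalState X - A.finalState Y)‖ ^ 2 ≤
      ∑ j, ‖A.proj j (A.finalState X - A.finalState Y)‖ ^ 2 :=
    Finset.sum_le_sum_of_subset_of_nonneg (Finset.subset_univ _) fun _ _ _ => by positivity
  refine le_trans ?_ (add_le_add_right (mul_le_mul_of_nonneg_left h (by norm_num)) _)
  rw [Finset.mul_sum, Finset.mul_sum, ← Finset.sum_add_distrib]
  refine Finset.sum_le_sum fun j _ => ?_
  unfold prob
  rw [map_sub]
  have h1 : ‖A.proj j (A.finalState X)‖ ≤ ‖A.proj j (A.finalState Y)‖ +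
      ‖A.proj j (A.finalState X) - A.proj j (A.finalState Y)‖ := by
    have := norm_add_le (A.proj j (A.finalState Y))
      (A.proj j (A.finalState X) - A.proj j (A.finalState Y))
    rwa [add_sub_cancel] at this
  have h2 := norm_nonneg (A.proj j (A.finalState X))
  nlinarith [sq_nonneg (‖A.proj j (A.finalState Y)‖ -
    8 * ‖A.proj j (A.finalState X) - A.proj j (A.finalState Y)‖)]

lemma error_nonneg (X : Input n) {p : ℝ} (hp : 0 < p) : 0 ≤ A.error X p := by
  refine Real.sInf_nonneg fun γ hγ => ?_
  by_contra h
  push Not at h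
  rw [Set.mem_ofPred_eq, Finset.sum_eq_zero] at hγ
  · linarith
  · intro j hj
    rw [Finset.mem_filter] at hj
    linarith [abs_nonneg (mean X - A.estimate j), hj.2]

open Classical in
lemma lt_sum_prob_of_error_lt (X : Input n) {p γ : ℝ} (hp : p ≤ 1) (h : A.error X p < γ) :
    p ≤ ∑ j ∈ Finset.univ.filter (fun j => |mean X - A.estimate j| < γ), A.prob X j := by
  -- Nonemptiness excludes the default value `sInf ∅ = 0`; a large `γ` captures every outcome, which
  -- suffices because `p ≤ 1`.
  have hne : {γ : ℝ | p ≤ ∑ j ∈ Finset.univ.filter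
      (fun j => |mean X - A.estimate j| ≤ γ), A.prob X j}.Nonempty := by
    refine ⟨∑ j, |mean X - A.estimate j|, ?_⟩
    rw [Set.mem_ofPred_eq, Finset.filter_true_of_mem, sum_prob]
    · exact hp
    · intro j hj
      exact Finset.single_le_sum (f := fun j => |mean X - A.estimate j|)
        (fun _ _ => abs_nonneg _) hj
  obtain ⟨γ', hγ', hlt⟩ := exists_lt_of_csInf_lt hne h
  refine hγ'.trans (Finset.sum_le_sum_of_subset_of_nonneg ?_ fun j _ _ => A.prob_nonneg X j)
  intro j hj
  rw [Finset.mem_filter] at hj ⊢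
  exact ⟨hj.1, hj.2.trans_lt hlt⟩

/-- Three well separated inputs cannot all have small errors if the final states are close. -/
lemma error_add_error_add_error_ge {p : ℝ} (hp : 1 / 2 < p) (hp1 : p ≤ 1) (hn : 0 < n)
    {k d : ℕ} {X Y Z : Input n} (hX : ones X = k) (hY : ones Y = k + d)
    (hZ : ones Z = k + d + d) :
    (d : ℝ) / 2 * (1 - 24 * (‖A.finalState X - A.finalState Y‖ ^ 2 +
      ‖A.finalState Y - A.finalState Z‖ ^ 2)) ≤
      n * A.error X p + n * A.error Y p + n * A.error Z p := by
  classical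
  have hn' : (0 : ℝ) < n := by exact_mod_cast hn
  have hp0 : 0 < p := by linarith
  have hd0 : (0 : ℝ) ≤ d / 2 := by positivity
  have eX := mul_nonneg hn'.le (A.error_nonneg X hp0)
  have eY := mul_nonneg hn'.le (A.error_nonneg Y hp0)
  have eZ := mul_nonneg hn'.le (A.error_nonneg Z hp0)
  by_cases hS : 1 ≤ 24 * (‖A.finalState X - A.finalState Y‖ ^ 2 +
      ‖A.finalState Y - A.finalState Z‖ ^ 2)
  · have h := mul_nonpos_of_nonneg_of_nonpos hd0 (sub_nonpos.mpr hS)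
    linarith
  push Not at hS
  refine le_trans (b := (d : ℝ) / 2) (mul_le_of_le_one_right (by positivity)
    (sub_le_self _ (by positivity))) ?_
  by_contra hcon
  push Not at hcon
  have small : ∀ W : Input n, n * A.error W p < d / 2 → A.error W p < d / 2 / n := by
    intro W hW
    rw [lt_div_iff₀ hn']
    linarith
  have qX := A.lt_sum_prob_of_error_lt X hp1 (small X (by linarith))
  have qY := A.lt_sum_prob_of_error_lt Y hp1 (small Y (by linarith))
  have qZ := A.lt_sum_prob_of_error_lt Z hp1 (small Z (by linarith))
  have hdisj : ∀ V W : Input n, (ones V : ℝ) + d ≤ ones W →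
      Disjoint (Finset.univ.filter (fun j => |mean V - A.estimate j| < d / 2 / n))
        (Finset.univ.filter (fun j => |mean W - A.estimate j| < d / 2 / n)) := by
    intro V W h
    rw [Finset.disjoint_filter]
    intro j _ h1 h2
    rw [abs_lt] at h1 h2
    have h3 : mean V + d / n ≤ mean W := by
      unfold mean
      rw [← add_div]
      gcongr
    have h4 : (d : ℝ) / 2 / n = d / n / 2 := by ring
    linarith [h1.1, h2.2]
  have dXY := hdisj X Y (by rw [hX, hY]; push_cast; linarith)
  have dYZ := hdisj Y Z (by rw [hY, hZ]; push_cast; linarith)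
  have dXZ := hdisj X Z (by rw [hX, hZ]; push_cast; linarith)
  set I := Finset.univ.filter (fun j => |mean X - A.estimate j| < (d : ℝ) / 2 / n)
  set J := Finset.univ.filter (fun j => |mean Y - A.estimate j| < (d : ℝ) / 2 / n)
  set K := Finset.univ.filter (fun j => |mean Z - A.estimate j| < (d : ℝ) / 2 / n)
  have htot : ∑ j ∈ I, A.prob Y j + ∑ j ∈ J, A.prob Y j + ∑ j ∈ K, A.prob Y j ≤ 1 := by
    rw [← Finset.sum_union dXY,
      ← Finset.sum_union (Finset.disjoint_union_left.mpr ⟨dXZ, dYZ⟩), ← A.sum_prob Y]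
    exact Finset.sum_le_sum_of_subset_of_nonneg (Finset.subset_univ _)
      fun j _ _ => A.prob_nonneg Y j
  have cX := A.sum_prob_le X Y I
  have cZ := A.sum_prob_le Z Y K
  rw [norm_sub_rev (A.finalState Z)] at cZ
  have hJ : 0 ≤ ∑ j ∈ J, A.prob Y j := Finset.sum_nonneg fun j _ => A.prob_nonneg Y j
  -- On input `Y` the three events would have total probability at least `p + 8/9 * 2p - 8D`, where
  -- `D` is the sum of the two squared distances. Since `24 D < 1`, this exceeds `25/18 - 1/3 > 1`.
  linarith

/-! ### Averages over levels -/

/-- The mean of `n · error` over the inputs with `k` ones. -/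
noncomputable def levelError (p : ℝ) (k : ℕ) : ℝ :=
  (∑ σ : Equiv.Perm (Fin n), n * A.error (thresholdInput k σ) p) / (n.factorial : ℝ)

lemma levelError_nonneg {p : ℝ} (hp : 0 < p) (k : ℕ) : 0 ≤ A.levelError p k :=
  div_nonneg (Finset.sum_nonneg fun σ _ => mul_nonneg (by positivity) (A.error_nonneg _ hp))
    (by positivity)

lemma levelError_add_ge {p : ℝ} (hp : 1 / 2 < p) (hp1 : p ≤ 1) (hn : 0 < n)
    {k d : ℕ} (hk : n ≤ 4 * (k + d)) (hk' : 4 * (k + d + d) ≤ 3 * n)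
    (hT : (T : ℝ) * d ≤ n / 1536) :
    (d : ℝ) / 4 ≤ A.levelError p k + A.levelError p (k + d) + A.levelError p (k + d + d) := by
  have hn' : (0 : ℝ) < n := by exact_mod_cast hn
  have hf : (0 : ℝ) < n.factorial := by positivity
  have key := Finset.sum_le_sum fun (σ : Equiv.Perm (Fin n)) (_ : σ ∈ Finset.univ) =>
    A.error_add_error_add_error_ge hp hp1 hn
      (ones_thresholdInput (show k ≤ n by omega) σ)
      (ones_thresholdInput (show k + d ≤ n by omega) σ)
      (ones_thresholdInput (show k + d + d ≤ n by omega) σ)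
  have h1 := A.sum_perm_norm_state_sub_sq_le (k := k) (d := d) (by omega) (by omega) hn
    (Fin.last T)
  have h2 := A.sum_perm_norm_state_sub_sq_le (k := k + d) (d := d) (by omega) (by omega) hn
    (Fin.last T)
  rw [Fin.val_last] at h1 h2
  -- The two mean squared distances then sum to at most `1 / 48`, so the factor `1 - 24 * (…)` is at
  -- least `1 / 2` on average.
  have hT' : (T : ℝ) * (16 * d / n) ≤ 1 / 96 := by
    rw [← mul_div_assoc, div_le_iff₀ hn']
    linarith
  have hT'' := mul_le_mul_of_nonneg_right hT' hf.le
  rw [← Finset.mul_sum, Finset.sum_sub_distrib, ← Finset.mul_sum, Finset.sum_add_distrib,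
    Finset.sum_const, Finset.card_univ, Fintype.card_perm, Fintype.card_fin,
    Finset.sum_add_distrib, Finset.sum_add_distrib, nsmul_eq_mul, mul_one] at key
  unfold levelError
  rw [← add_div, ← add_div, le_div_iff₀ hf]
  refine le_trans ?_ key
  rw [div_mul_eq_mul_div, div_mul_eq_mul_div, div_le_div_iff₀ (by norm_num) (by norm_num)]
  have : (n.factorial : ℝ) / 2 ≤ (n.factorial : ℝ) - 24 *
      (∑ σ : Equiv.Perm (Fin n), ‖A.finalState (thresholdInput k σ) -
        A.finalState (thresholdInput (k + d) σ)‖ ^ 2 +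
       ∑ σ : Equiv.Perm (Fin n), ‖A.finalState (thresholdInput (k + d) σ) -
        A.finalState (thresholdInput (k + d + d) σ)‖ ^ 2) := by
    unfold finalState
    linarith
  have h3 := mul_le_mul_of_nonneg_left this (show (0 : ℝ) ≤ d by positivity)
  linarith

end QueryAlgorithm

/-! ### Decomposition of the cube into levels -/

lemma exists_perm_comp_eq {n : ℕ} {X Y : Input n} (h : ones X = ones Y) :
    ∃ τ : Equiv.Perm (Fin n), X = Y ∘ τ := by
  have hc : Fintype.card {i // X i = true} = Fintype.card {i // Y i = true} := by
    rw [Fintype.card_subtype, Fintype.card_subtype]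
    exact h
  let e := Fintype.equivOfCardEq hc
  refine ⟨e.extendSubtype, funext fun i => ?_⟩
  by_cases hi : X i = true
  · rw [Function.comp_apply, hi, e.extendSubtype_mem i hi]
  · have := e.extendSubtype_not_mem i hi
    rw [Function.comp_apply, Bool.eq_false_iff.mpr hi, Bool.eq_false_iff.mpr this]

lemma ones_le {n : ℕ} (X : Input n) : ones X ≤ n := by
  simpa [ones] using Finset.card_filter_le (Finset.univ : Finset (Fin n)) fun i => X i = true

lemma card_filter_ones_eq (n k : ℕ) :
    (Finset.univ.filter fun X : Input n => ones X = k).card = n.choose k := by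
  have h := Finset.card_powersetCard k (Finset.univ : Finset (Fin n))
  rw [Finset.card_univ, Fintype.card_fin] at h
  rw [← h]
  refine Finset.card_bij' (fun X _ => Finset.univ.filter fun i => X i = true)
    (fun s _ i => decide (i ∈ s)) ?_ ?_ ?_ ?_
  · intro X hX
    exact Finset.mem_powersetCard.mpr ⟨Finset.subset_univ _, (Finset.mem_filter.mp hX).2⟩
  · intro s hs
    refine Finset.mem_filter.mpr ⟨Finset.mem_univ _, ?_⟩
    simpa [ones] using (Finset.mem_powersetCard.mp hs).2
  · intro X _
    funext i
    simp
  · intro s _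
    ext i
    simp

lemma sum_perm_comp_eq {n : ℕ} (f : Input n → ℝ) (X : Input n) :
    ∑ τ : Equiv.Perm (Fin n), f (X ∘ τ) =
      ∑ τ : Equiv.Perm (Fin n), f (thresholdInput (ones X) τ) := by
  obtain ⟨ρ, hρ⟩ := exists_perm_comp_eq (X := X) (Y := thresholdInput (ones X) 1)
    (ones_thresholdInput (ones_le X) 1).symm
  rw [← Equiv.sum_comp (Equiv.mulLeft ρ)
    (fun τ : Equiv.Perm (Fin n) => f (thresholdInput (ones X) τ))]
  refine Finset.sum_congr rfl fun τ _ => ?_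
  congr 1
  conv_lhs => rw [hρ]
  rfl

/-- Summation over the cube is invariant under permuting coordinates, and the orbit of an input is
its level, so `f` may be replaced by its orbit averages. -/
lemma factorial_mul_sum_eq {n : ℕ} (f : Input n → ℝ) :
    (n.factorial : ℝ) * ∑ X, f X = ∑ k ∈ Finset.range (n + 1),
      (n.choose k : ℝ) * ∑ σ : Equiv.Perm (Fin n), f (thresholdInput k σ) := by
  calc (n.factorial : ℝ) * ∑ X, f X
      = ∑ τ : Equiv.Perm (Fin n), ∑ X : Input n, f (X ∘ τ) := by
        have h : ∀ τ : Equiv.Perm (Fin n), ∑ X : Input n, f (X ∘ τ) = ∑ X, f X := fun τ =>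
          Equiv.sum_comp (Equiv.arrowCongr τ.symm (Equiv.refl Bool)) f
        simp only [h]
        rw [Finset.sum_const, Finset.card_univ, Fintype.card_perm, Fintype.card_fin, nsmul_eq_mul]
    _ = ∑ X : Input n, ∑ τ : Equiv.Perm (Fin n), f (thresholdInput (ones X) τ) := by
        rw [Finset.sum_comm]
        exact Finset.sum_congr rfl fun X _ => sum_perm_comp_eq f X
    _ = ∑ k ∈ Finset.range (n + 1), ∑ X ∈ Finset.univ.filter (fun X : Input n => ones X = k),
          ∑ τ : Equiv.Perm (Fin n), f (thresholdInput (ones X) τ) :=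
        (Finset.sum_fiberwise_of_maps_to
          (fun X _ => Finset.mem_range.mpr (Nat.lt_succ_of_le (ones_le X))) _).symm
    _ = _ := by
        refine Finset.sum_congr rfl fun k _ => ?_
        rw [← card_filter_ones_eq n k, ← nsmul_eq_mul, ← Finset.sum_const]
        refine Finset.sum_congr rfl fun X hX => ?_
        rw [(Finset.mem_filter.mp hX).2]

lemma QueryAlgorithm.avgCountError_muOne {n T : ℕ} (A : QueryAlgorithm n T) (p : ℝ) :
    A.avgCountError (muOne n) p =
      ∑ k ∈ Finset.range (n + 1), (n.choose k : ℝ) / 2 ^ n * A.levelError p k := by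
  have h := factorial_mul_sum_eq fun X : Input n => n * A.error X p
  have hf : (n.factorial : ℝ) ≠ 0 := by positivity
  unfold avgCountError avgError muOne
  rw [← Finset.sum_mul, ← mul_assoc, Finset.mul_sum]
  rw [mul_comm, ← eq_div_iff hf] at h
  rw [h, Finset.sum_div, Finset.sum_mul]
  refine Finset.sum_congr rfl fun k _ => ?_
  unfold levelError
  ring

end QuantumCounting

namespace QuantumCounting

/-! ### The lower bound for a fixed number of variables -/

lemma QueryAlgorithm.avgCountError_ge {n T s d : ℕ} (A : QueryAlgorithm n T) {p : ℝ}
    (hp : 1 / 2 < p) (hp1 : p ≤ 1) (hn : 10000 ≤ n) (hs : 100 * s ^ 2 ≤ n)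
    (hs' : Real.sqrt n ≤ 20 * s) (hd : d ≤ s) (hT : (T : ℝ) * d ≤ n / 1536) :
    (d : ℝ) / 1920 ≤ A.avgCountError (muOne n) p := by
  have hp0 : 0 < p := by linarith
  have hs0 : 100 * s ≤ n := by nlinarith
  have hsq : 0 < Real.sqrt n := Real.sqrt_pos.mpr (by exact_mod_cast (by omega : 0 < n))
  obtain ⟨m, hm⟩ : ∃ m, m = n / 2 := ⟨_, rfl⟩
  -- The `s` triples `m + j`, `m + j + d`, `m + j + 2d` stay in a window of length `3s` because `d ≤
  -- s`, and each level occurs in at most three of them.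
  have hsum : (s : ℝ) * (d / 4) ≤ 3 * ∑ j ∈ Finset.range (3 * s), A.levelError p (m + j) := by
    have hshift : ∀ a ≤ 2 * s, ∑ j ∈ Finset.range s, A.levelError p (m + j + a) ≤
        ∑ j ∈ Finset.range (3 * s), A.levelError p (m + j) := by
      intro a ha
      have h := Finset.sum_Ico_add (fun j => A.levelError p (m + j)) 0 s a
      rw [← Finset.range_eq_Ico] at h
      have h' : ∑ j ∈ Finset.range s, A.levelError p (m + j + a) =
          ∑ j ∈ Finset.range s, A.levelError p (m + (a + j)) :=
        Finset.sum_congr rfl fun j _ => by rw [add_assoc, add_comm j a]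
      rw [h', h]
      refine Finset.sum_le_sum_of_subset_of_nonneg ?_ fun j _ _ => A.levelError_nonneg hp0 _
      intro j hj
      rw [Finset.mem_Ico] at hj
      rw [Finset.mem_range]
      omega
    calc (s : ℝ) * (d / 4) = ∑ j ∈ Finset.range s, (d : ℝ) / 4 := by simp
      _ ≤ ∑ j ∈ Finset.range s, (A.levelError p (m + j + 0) + A.levelError p (m + j + d) +
            A.levelError p (m + j + (d + d))) := by
          refine Finset.sum_le_sum fun j hj => ?_
          rw [Finset.mem_range] at hj
          rw [← add_assoc (m + j) d d]
          exact A.levelError_add_ge hp hp1 (by omega) (by omega) (by omega) hT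
      _ ≤ 3 * ∑ j ∈ Finset.range (3 * s), A.levelError p (m + j) := by
          rw [Finset.sum_add_distrib, Finset.sum_add_distrib]
          linarith [hshift 0 (by omega), hshift d (by omega), hshift (d + d) (by omega)]
  have havg : 1 / (8 * Real.sqrt n) * ∑ j ∈ Finset.range (3 * s), A.levelError p (m + j) ≤
      A.avgCountError (muOne n) p := by
    rw [A.avgCountError_muOne, Finset.mul_sum]
    calc ∑ j ∈ Finset.range (3 * s), 1 / (8 * Real.sqrt n) * A.levelError p (m + j)
        ≤ ∑ j ∈ Finset.range (3 * s),
            (n.choose (m + j) : ℝ) / 2 ^ n * A.levelError p (m + j) := by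
          refine Finset.sum_le_sum fun j hj => ?_
          rw [Finset.mem_range] at hj
          refine mul_le_mul_of_nonneg_right ?_ (A.levelError_nonneg hp0 _)
          have h2 : 2 * j ^ 2 ≤ n / 2 := by
            have : j ^ 2 ≤ (3 * s) ^ 2 := Nat.pow_le_pow_left hj.le 2
            have h9 : (3 * s) ^ 2 = 9 * s ^ 2 := by ring
            omega
          have h3 := two_pow_le_choose_half_add (by omega) h2
          rw [← hm] at h3
          rw [div_le_div_iff₀ (by positivity) (by positivity)]
          linarith
      _ = ∑ k ∈ Finset.Ico m (m + 3 * s), (n.choose k : ℝ) / 2 ^ n * A.levelError p k := by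
          rw [Finset.sum_Ico_eq_sum_range, Nat.add_sub_cancel_left]
      _ ≤ ∑ k ∈ Finset.range (n + 1), (n.choose k : ℝ) / 2 ^ n * A.levelError p k := by
          refine Finset.sum_le_sum_of_subset_of_nonneg ?_ fun k _ _ =>
            mul_nonneg (by positivity) (A.levelError_nonneg hp0 _)
          intro k hk
          rw [Finset.mem_Ico] at hk
          rw [Finset.mem_range]
          omega
  refine le_trans ?_ havg
  rw [div_mul_eq_mul_div, one_mul, div_le_div_iff₀ (by norm_num) (by positivity)]
  -- The constant is `1920 = 8 * 12 * 20`: binomial mass, `d / 4` shared over triple counting, and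
  -- `√n ≤ 20 s`.
  have hd0 : (0 : ℝ) ≤ d := by positivity
  nlinarith [mul_le_mul_of_nonneg_left hs' hd0]

lemma QueryAlgorithm.avgCountError_ge_of_le_sqrt {n T d : ℕ} (A : QueryAlgorithm n T) {p : ℝ}
    (hp : 1 / 2 < p) (hp1 : p ≤ 1) (hn : 10000 ≤ n) (hd : (d : ℝ) ≤ Real.sqrt n / 20)
    (hT : (T : ℝ) * d ≤ n / 1536) :
    (d : ℝ) / 1920 ≤ A.avgCountError (muOne n) p := by
  have hsqrt : (100 : ℝ) ≤ Real.sqrt n := by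
    rw [Real.le_sqrt' (by norm_num)]
    have : (10000 : ℝ) ≤ n := by exact_mod_cast hn
    linarith
  have h1 := Nat.floor_le (show 0 ≤ Real.sqrt n / 10 by positivity)
  have h2 := Nat.lt_floor_add_one (Real.sqrt n / 10)
  have h3 : Real.sqrt n ≤ 20 * (⌊Real.sqrt n / 10⌋₊ : ℝ) := by linarith
  refine A.avgCountError_ge (s := ⌊Real.sqrt n / 10⌋₊) hp hp1 hn ?_ h3 ?_ hT
  · have h4 : (10 * (⌊Real.sqrt n / 10⌋₊ : ℝ)) ^ 2 ≤ n := by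
      rw [← Real.le_sqrt (by positivity) (by positivity)]
      linarith
    have h5 : (100 : ℝ) * (⌊Real.sqrt n / 10⌋₊ : ℝ) ^ 2 ≤ n := by linarith
    exact_mod_cast h5
  · have h4 : (d : ℝ) ≤ (⌊Real.sqrt n / 10⌋₊ : ℝ) := by linarith
    exact_mod_cast h4

end QuantumCounting

/-- In the first part `max 1 T` replaces `T`, so that `T = 0` is covered: there `n / T` means `+∞`
and the minimum is `√n`, while for `T ≥ 1` nothing changes. The constants are absolute. -/
theorem corollary3p2 :
    (∃ c : ℝ, 0 < c ∧ ∀ p : ℝ, 1 / 2 < p → p ≤ 1 → ∀ T : ℕ → ℕ,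
      (fun n : ℕ => (T n : ℝ)) =o[atTop] (fun n : ℕ => (n : ℝ)) →
      ∀ᶠ n : ℕ in atTop, ∀ A : QuantumCounting.QueryAlgorithm n (T n),
        c * min (Real.sqrt (n : ℝ)) ((n : ℝ) / max 1 (T n : ℝ)) ≤
          A.avgCountError (QuantumCounting.muOne n) p) ∧
    (∃ c : ℝ, 0 < c ∧ ∀ p : ℝ, 1 / 2 < p → p ≤ 1 → ∀ Δ : ℕ → ℝ, (∀ n, 0 < Δ n) →
      Δ =o[atTop] (fun n : ℕ => Real.sqrt (n : ℝ)) →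
      ∀ᶠ n : ℕ in atTop, ∀ (T : ℕ) (A : QuantumCounting.QueryAlgorithm n T),
        A.avgCountError (QuantumCounting.muOne n) p ≤ Δ n →
          c * min ((n : ℝ) / Δ n) (n : ℝ) ≤ (T : ℝ)) := by
  constructor
  · refine ⟨1 / (2 * 1536 * 1920), by norm_num, fun p hp hp1 T hT => ?_⟩
    filter_upwards [hT.bound (show (0 : ℝ) < 1 / 1536 by norm_num),
      eventually_ge_atTop (1536 ^ 2)] with n hTn hn A
    rw [Real.norm_of_nonneg (by positivity), Real.norm_of_nonneg (by positivity)] at hTn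
    have hn' : (1536 ^ 2 : ℝ) ≤ n := by exact_mod_cast hn
    have hsqrt : (1536 : ℝ) ≤ Real.sqrt n := Real.le_sqrt_of_sq_le hn'
    have hM : (0 : ℝ) < max 1 (T n : ℝ) := lt_max_of_lt_left one_pos
    have hMn : max 1 (T n : ℝ) ≤ n / 1536 := max_le (by linarith) (by linarith)
    -- The gap is `d = ⌊x⌋₊`. The assumption `T = o(n)` ensures `x ≥ 1`, so rounding down costs at
    -- most a factor `2`.
    obtain ⟨x, hx⟩ : ∃ x, x = min (Real.sqrt n) ((n : ℝ) / max 1 (T n : ℝ)) / 1536 := ⟨_, rfl⟩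
    have hx1 : 1 ≤ x := by
      rw [hx, le_div_iff₀ (by norm_num), one_mul, le_min_iff, le_div_iff₀ hM]
      exact ⟨hsqrt, by linarith⟩
    have hxs : x ≤ Real.sqrt n / 1536 := by
      rw [hx]
      gcongr
      exact min_le_left _ _
    have hxT : max 1 (T n : ℝ) * x ≤ n / 1536 := by
      have h : x ≤ (n : ℝ) / max 1 (T n : ℝ) / 1536 := by
        rw [hx]
        gcongr
        exact min_le_right _ _
      calc max 1 (T n : ℝ) * x ≤ max 1 (T n : ℝ) * ((n : ℝ) / max 1 (T n : ℝ) / 1536) := by gcongr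
        _ = n / 1536 := by field_simp
    have hfl := Nat.floor_le (zero_le_one.trans hx1)
    have hfl' := Nat.lt_floor_add_one x
    have hfl1 : (1 : ℝ) ≤ (⌊x⌋₊ : ℝ) := by
      exact_mod_cast Nat.one_le_floor_iff x |>.mpr hx1
    have h := A.avgCountError_ge_of_le_sqrt (d := ⌊x⌋₊) hp hp1 (by omega) (by linarith)
      (by
        refine le_trans ?_ hxT
        gcongr
        exact le_max_right _ _)
    refine le_trans ?_ h
    rw [show 1 / (2 * 1536 * 1920) * min (Real.sqrt n) ((n : ℝ) / max 1 (T n : ℝ)) =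
      x / 2 / 1920 by rw [hx]; ring]
    gcongr
    linarith
  · refine ⟨1 / (1536 * 1921), by norm_num, fun p hp hp1 Δ hΔ hΔo => ?_⟩
    filter_upwards [hΔo.bound (show (0 : ℝ) < 1 / (40 * 1920) by norm_num),
      eventually_ge_atTop 10000] with n hΔn hn T A hA
    have hΔ0 := hΔ n
    rw [Real.norm_of_nonneg hΔ0.le, Real.norm_of_nonneg (by positivity)] at hΔn
    have hn' : (10000 : ℝ) ≤ n := by exact_mod_cast hn
    have hn0 : (0 : ℝ) < n := by linarith
    have hsqrt : (100 : ℝ) ≤ Real.sqrt n := Real.le_sqrt_of_sq_le (by linarith)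
    by_contra hcon
    push Not at hcon
    have hfl := Nat.floor_le (show 0 ≤ 1920 * Δ n by positivity)
    have hfl' := Nat.lt_floor_add_one (1920 * Δ n)
    have hTΔ : (T : ℝ) * Δ n ≤ n / (1536 * 1921) := by
      have h : (T : ℝ) ≤ 1 / (1536 * 1921) * ((n : ℝ) / Δ n) := hcon.le.trans (by
        gcongr
        exact min_le_left _ _)
      calc (T : ℝ) * Δ n ≤ 1 / (1536 * 1921) * ((n : ℝ) / Δ n) * Δ n := by gcongr
        _ = n / (1536 * 1921) := by field_simp
    have hTn : (T : ℝ) ≤ n / (1536 * 1921) := hcon.le.trans (by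
      have := min_le_right ((n : ℝ) / Δ n) n
      linarith)
    -- This is the least integer `d` with `d / 1920 > Δ n`, contradicting `hA`. In bounding `T * d`,
    -- the term `n / Δ` of the minimum controls `T * 1920 Δ` and the term `n` controls the added
    -- `1`, whence `1921`.
    have h := A.avgCountError_ge_of_le_sqrt (d := ⌊1920 * Δ n⌋₊ + 1) hp hp1 hn
      (by push_cast; linarith)
      (by
        push_cast
        calc (T : ℝ) * ((⌊1920 * Δ n⌋₊ : ℝ) + 1) ≤ T * (1920 * Δ n + 1) := by gcongr
          _ ≤ n / 1536 := by linarith)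
    push_cast at h
    linarith
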